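/- Let $k\ge 1$ and $1\le i\le k+1$ be integers, let $q$ be a complex number with $|q|<1$, and let $q^{1/2}$ be a fixed square root of $q$; write $q^{m/2}=(q^{1/2})^m$ for integers $m\ge 0$. Put $(a;q)_n=\prod_{j=0}^{n-1}(1-aq^j)$, $(a;q)_\infty=\prod_{j=0}^{\infty}(1-aq^j)$ and $(a_1,\dots,a_m;q)_\infty=(a_1;q)_\infty\cdots(a_m;q)_\infty$. For non-negative integers $n_1,\dots,n_k$ let $N_j=n_j+n_{j+1}+\cdots+n_k$ for $1\le j\le k$ and $N_j=0$ for $j>k$. Then the following series converges absolutely and $$\sum_{n_1,\dots,n_k\ge 0}\frac{q^{N_1^2+N_2^2+\cdots+N_k^2+N_i+N_{i+1}+\cdots+N_k}}{(q;q)_{n_1}\cdots(q;q)_{n_{k-1}}\,(-q^{1/2};q)_{n_k}\,(q^2;q^2)_{n_k}}=\frac{\bigl(q^{i},\,q^{\frac32+2k-i},\,q^{\frac32+2k};\,q^{\frac32+2k}\bigr)_\infty}{(q;q)_\infty}.$$ -/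

import Mathlib

noncomputable section

/-- The infinite `q`-shifted factorial `(a; q)_∞ = ∏_{j ≥ 0} (1 - a q^j)`, for `‖q‖ < 1`. -/
def qPochInf (a q : ℂ) : ℂ := ∏' j : ℕ, (1 - a * q ^ j)

/-- The finite `q`-shifted factorial `(a; q)_n = ∏_{j=0}^{n-1} (1 - a q^j)`. -/
def qPoch (a q : ℂ) (n : ℕ) : ℂ := ∏ j ∈ Finset.range n, (1 - a * q ^ j)

/-- The infinite product defining `(a; q)_∞` converges whenever `‖q‖ < 1`. -/
theorem multipliable_qPochInf (a : ℂ) {q : ℂ} (hq : ‖q‖ < 1) :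
    Multipliable fun j : ℕ => 1 - a * q ^ j := by
  have h : Summable fun j : ℕ => ‖-(a * q ^ j)‖ := by
    simpa [norm_mul, norm_pow] using
      (summable_geometric_of_lt_one (norm_nonneg q) hq).mul_left ‖a‖
  simpa [sub_eq_add_neg] using multipliable_one_add_of_summable h

/-- The entry `n_j` of a `k`-tuple `n = (n_1, …, n_k)`, numbered from `1` to `k`
(and `0` for any other `j`). -/
def entry {k : ℕ} (n : Fin k → ℕ) (j : ℕ) : ℕ :=
  if h : 1 ≤ j ∧ j ≤ k then n ⟨j - 1, by omega⟩ else 0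

/-- The tail sum `N_j = n_j + n_{j+1} + ⋯ + n_k`, which is `0` for `j > k`. -/
def tailSum {k : ℕ} (n : Fin k → ℕ) (j : ℕ) : ℕ := ∑ l ∈ Finset.Icc j k, entry n l

/-- The exponent `N_1² + ⋯ + N_k² + N_i + N_{i+1} + ⋯ + N_k`. -/
def sumExponent {k : ℕ} (i : ℕ) (n : Fin k → ℕ) : ℕ :=
  ∑ j ∈ Finset.Icc 1 k, tailSum n j ^ 2 + ∑ j ∈ Finset.Icc i k, tailSum n j

/-- The denominator
`(q; q)_{n_1} ⋯ (q; q)_{n_{k-1}} (-s; q)_{n_k} (q²; q²)_{n_k}`, where `s` stands for `q^{1/2}`. -/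
def sumDenominator {k : ℕ} (q s : ℂ) (n : Fin k → ℕ) : ℂ :=
  (∏ j ∈ Finset.Icc 1 (k - 1), qPoch q q (entry n j)) *
    qPoch (-s) q (entry n k) * qPoch (q ^ 2) (q ^ 2) (entry n k)

end

open Filter Topology

/-! The proof runs the Bailey chain on bilateral sums. Write `s` for `q^{1/2}`, and let B_{c,j}(A,C)
be the sum over all integers r of (-1)^r s^{c r(r-1)/2 + j r} / ((q;q)_{A-r} (q;q)_{C+r}). The seed
is `bilSum_thetaTerm_three`: the innermost denominator is 1 / B_{3,2}(N,N). Summing B_{c,j}(M,M)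
against q^{M²}/(q;q)_{N-M} gives B_{c+4,j+2}(N,N). For j = 2 the kernel q^{M²+M}/(q;q)_{N-M} gives
B_{c+4,2}(N,N). Working outwards from n_k, the k-i+1 sums carrying a linear term N_j keep j = 2, and
the other i-1 sums raise it to 2i, while c reaches 4k+3. This is `hasSum_multisum_finite`. Letting N
→ ∞ turns B into a theta series over (q;q)_∞², one factor cancels against the multisum side, and the
Jacobi triple product `tsum_thetaTerm` evaluates the series. -/

/-! ### Reciprocal q-factorials on the integers -/

/-- The reciprocal `1 / (p; p)_m`, extended by `0` to negative `m`. -/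
noncomputable def recipPoch (p : ℂ) (m : ℤ) : ℂ :=
  if 0 ≤ m then (qPoch p p m.toNat)⁻¹ else 0

theorem recipPoch_of_neg (p : ℂ) {m : ℤ} (hm : m < 0) : recipPoch p m = 0 := by
  simp [recipPoch, not_le.mpr hm]

@[simp] theorem recipPoch_natCast (p : ℂ) (m : ℕ) : recipPoch p m = (qPoch p p m)⁻¹ := by
  simp [recipPoch]

@[simp] theorem recipPoch_zero (p : ℂ) : recipPoch p 0 = 1 := by
  simp [recipPoch, qPoch]

theorem one_sub_ne_zero_of_norm_lt_one {x : ℂ} (hx : ‖x‖ < 1) : 1 - x ≠ 0 := by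
  intro h
  rw [sub_eq_zero] at h
  simp [← h] at hx

theorem norm_pow_lt_one {p : ℂ} (hp : ‖p‖ < 1) {n : ℕ} (hn : n ≠ 0) : ‖p ^ n‖ < 1 := by
  rw [norm_pow]
  exact pow_lt_one₀ (norm_nonneg _) hp hn

theorem qPoch_ne_zero {a p : ℂ} (ha : ‖a‖ < 1) (hp : ‖p‖ < 1) (n : ℕ) : qPoch a p n ≠ 0 := by
  refine Finset.prod_ne_zero_iff.mpr fun j _ => one_sub_ne_zero_of_norm_lt_one ?_
  rw [norm_mul, norm_pow]
  exact mul_lt_one_of_nonneg_of_lt_one_left (norm_nonneg _) ha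
    (pow_le_one₀ (norm_nonneg _) hp.le)

theorem qPoch_succ (a p : ℂ) (n : ℕ) : qPoch a p (n + 1) = qPoch a p n * (1 - a * p ^ n) :=
  Finset.prod_range_succ _ _

/-- At m = 0 the factor 1 - p^m vanishes, matching the extension by zero, so Pascal-type arguments
need no boundary cases. -/
theorem recipPoch_sub_one {p : ℂ} (hp : ‖p‖ < 1) (m : ℤ) :
    recipPoch p (m - 1) = (1 - p ^ m) * recipPoch p m := by
  rcases lt_trichotomy m 0 with h | rfl | h
  · rw [recipPoch_of_neg p h, recipPoch_of_neg p (by omega), mul_zero]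
  · simp [recipPoch]
  · obtain ⟨n, rfl⟩ : ∃ n : ℕ, m = (n + 1 : ℕ) := ⟨(m - 1).toNat, by omega⟩
    have h1 : ((n + 1 : ℕ) : ℤ) - 1 = (n : ℕ) := by push_cast; ring
    have h2 : 1 - p ^ (n + 1) ≠ 0 :=
      one_sub_ne_zero_of_norm_lt_one (norm_pow_lt_one hp n.succ_ne_zero)
    have h3 := qPoch_ne_zero hp hp n
    rw [h1, recipPoch_natCast, recipPoch_natCast, qPoch_succ, zpow_natCast, ← pow_succ']
    field_simp

/-! ### The kernel of the Bailey chain -/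

/-- The `q`-Vandermonde sum in its Durfee rectangle form. -/
theorem sum_durfee_rectangle {q : ℂ} (hq : ‖q‖ < 1) (hq0 : q ≠ 0) (A : ℕ) :
    ∀ B : ℤ, ∑ m ∈ Finset.range (A + 1), q ^ ((m : ℤ) ^ 2 + m * B) *
      recipPoch q ((A : ℤ) - m) * recipPoch q m * recipPoch q (m + B) =
        recipPoch q A * recipPoch q (A + B) := by
  induction A with
  | zero => intro B; simp [qPoch]
  | succ A ih =>
    intro B
    have hA : 1 - q ^ ((A : ℤ) + 1) ≠ 0 := by
      have := one_sub_ne_zero_of_norm_lt_one (norm_pow_lt_one hq A.succ_ne_zero)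
      exact_mod_cast this
    apply mul_left_cancel₀ hA
    -- Split 1 - q^{A+1} as (1 - q^{A+1-m}) + q^{A+1-m}(1 - q^m); each bracket lowers the index of
    -- one reciprocal. The first part is the sum for (A, B). The second, after m → m+1, is q^{A+1+B}
    -- times the sum for (A, B+1), so the induction must keep B general.
    have key : ∀ m : ℕ, (1 - q ^ ((A : ℤ) + 1)) * (q ^ ((m : ℤ) ^ 2 + m * B) *
        recipPoch q ((A + 1 : ℕ) - m) * recipPoch q m * recipPoch q (m + B)) =
        q ^ ((m : ℤ) ^ 2 + m * B) * recipPoch q ((A : ℤ) - m) * recipPoch q m *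
            recipPoch q (m + B) +
          q ^ ((m : ℤ) ^ 2 + m * B + (A + 1 - m)) * recipPoch q ((A : ℤ) + 1 - m) *
            recipPoch q (m - 1) * recipPoch q (m + B) := by
      intro m
      have e1 := recipPoch_sub_one hq ((A : ℤ) + 1 - m)
      have e2 := recipPoch_sub_one hq (m : ℤ)
      have e3 : q ^ ((A : ℤ) + 1) = q ^ ((A : ℤ) + 1 - m) * q ^ (m : ℤ) := by
        rw [← zpow_add₀ hq0]; congr 1; ring
      rw [show (A : ℤ) + 1 - m - 1 = A - m by ring] at e1
      rw [e1, e2, e3, zpow_add₀ hq0 _ ((A : ℤ) + 1 - m)]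
      push_cast
      ring
    rw [Finset.mul_sum, Finset.sum_congr rfl fun m _ => key m, Finset.sum_add_distrib,
      Finset.sum_range_succ, ih B,
      recipPoch_of_neg q (by push_cast; omega : (A : ℤ) - (A + 1 : ℕ) < 0),
      Finset.sum_range_succ' _ (A + 1)]
    have shift : ∀ m : ℕ, q ^ (((m + 1 : ℕ) : ℤ) ^ 2 + (m + 1 : ℕ) * B + (A + 1 - (m + 1 : ℕ))) *
          recipPoch q ((A : ℤ) + 1 - (m + 1 : ℕ)) *
            recipPoch q ((m + 1 : ℕ) - 1) * recipPoch q ((m + 1 : ℕ) + B) =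
        q ^ ((A : ℤ) + 1 + B) * (q ^ ((m : ℤ) ^ 2 + m * (B + 1)) *
      recipPoch q ((A : ℤ) - m) * recipPoch q m * recipPoch q (m + (B + 1))) := by
      intro m
      rw [show ((m + 1 : ℕ) : ℤ) ^ 2 + (m + 1 : ℕ) * B + (A + 1 - (m + 1 : ℕ)) =
        ((A : ℤ) + 1 + B) + ((m : ℤ) ^ 2 + m * (B + 1)) by push_cast; ring, zpow_add₀ hq0,
        show (A : ℤ) + 1 - (m + 1 : ℕ) = A - m by push_cast; ring,
        show ((m + 1 : ℕ) : ℤ) - 1 = m by push_cast; ring,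
        show ((m + 1 : ℕ) : ℤ) + B = m + (B + 1) by push_cast; ring]
      ring
    rw [Finset.sum_congr rfl fun m _ => shift m, ← Finset.mul_sum, ih (B + 1),
      recipPoch_of_neg q (by norm_num : ((0 : ℕ) : ℤ) - 1 < 0)]
    have e1 := recipPoch_sub_one hq ((A : ℤ) + 1)
    have e2 := recipPoch_sub_one hq ((A : ℤ) + 1 + B)
    rw [show (A : ℤ) + 1 - 1 = A by ring] at e1
    rw [show (A : ℤ) + 1 + B - 1 = A + B by ring] at e2
    rw [show (A : ℤ) + (B + 1) = A + 1 + B by ring, e1, e2]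
    push_cast
    ring

theorem sum_bailey_kernel_of_nonneg {q : ℂ} (hq : ‖q‖ < 1) (hq0 : q ≠ 0) (c : ℤ) (N r : ℕ) :
    ∑ n ∈ Finset.range (N + 1), q ^ ((n : ℤ) ^ 2 + c * n) * recipPoch q ((N : ℤ) - n) *
      (recipPoch q (n - r) * recipPoch q (n + r + c)) =
        q ^ ((r : ℤ) ^ 2 + c * r) * (recipPoch q (N - r) * recipPoch q (N + r + c)) := by
  rcases le_or_gt r N with h | h
  · obtain ⟨A, rfl⟩ := Nat.exists_eq_add_of_le h
    -- Terms with n < r vanish; n = r + m leaves the Durfee sum with A = N - r and B = 2r + c.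
    rw [add_assoc, Finset.sum_range_add, Finset.sum_eq_zero, zero_add]
    · have := sum_durfee_rectangle hq hq0 A (2 * r + c)
      rw [show ((r + A : ℕ) : ℤ) - r = A by push_cast; ring,
        show ((r + A : ℕ) : ℤ) + r + c = A + (2 * r + c) by push_cast; ring, ← this,
        Finset.mul_sum]
      refine Finset.sum_congr rfl fun m _ => ?_
      rw [show ((r + m : ℕ) : ℤ) - r = m by push_cast; ring,
        show ((r + m : ℕ) : ℤ) + r + c = m + (2 * r + c) by push_cast; ring,
        show ((r + A : ℕ) : ℤ) - (r + m : ℕ) = A - m by push_cast; ring,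
        show ((r + m : ℕ) : ℤ) ^ 2 + c * (r + m : ℕ) =
          ((r : ℤ) ^ 2 + c * r) + ((m : ℤ) ^ 2 + m * (2 * r + c)) by push_cast; ring,
        zpow_add₀ hq0 ((r : ℤ) ^ 2 + c * r)]
      ring
    · intro n hn
      rw [Finset.mem_range] at hn
      rw [recipPoch_of_neg q (by omega : (n : ℤ) - r < 0)]
      ring
  · rw [recipPoch_of_neg q (by omega : (N : ℤ) - r < 0), zero_mul, mul_zero]
    refine Finset.sum_eq_zero fun n hn => ?_
    rw [Finset.mem_range] at hn
    rw [recipPoch_of_neg q (by omega : (n : ℤ) - r < 0)]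
    ring

/-- The kernel identity behind the Bailey chain, for `a = q ^ c` with `c ≤ 1`. -/
theorem sum_bailey_kernel {q : ℂ} (hq : ‖q‖ < 1) (hq0 : q ≠ 0) {c : ℤ} (hc : c ≤ 1)
    (N : ℕ) (r : ℤ) :
    ∑ n ∈ Finset.range (N + 1), q ^ ((n : ℤ) ^ 2 + c * n) * recipPoch q ((N : ℤ) - n) *
      (recipPoch q (n - r) * recipPoch q (n + r + c)) =
        q ^ (r ^ 2 + c * r) * (recipPoch q (N - r) * recipPoch q (N + r + c)) := by
  rcases le_or_gt 0 r with h | h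
  · lift r to ℕ using h
    exact sum_bailey_kernel_of_nonneg hq hq0 c N r
  -- The identity is invariant under r → -r - c, and c ≤ 1 makes -r - c nonnegative when r < 0.
  · obtain ⟨t, ht⟩ : ∃ t : ℕ, r = -(t : ℤ) - c := ⟨(-r - c).toNat, by omega⟩
    subst ht
    have := sum_bailey_kernel_of_nonneg hq hq0 c N t
    rw [show (-(t : ℤ) - c) ^ 2 + c * (-(t : ℤ) - c) = (t : ℤ) ^ 2 + c * t by ring]
    have e : ∀ n : ℤ, recipPoch q (n - (-(t : ℤ) - c)) * recipPoch q (n + (-(t : ℤ) - c) + c) =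
        recipPoch q (n - t) * recipPoch q (n + t + c) := by
      intro n
      rw [mul_comm]
      congr 2 <;> ring
    simp only [e]
    exact this

/-! ### Limits and uniform bounds of q-factorials -/

theorem tendsto_qPoch (a : ℂ) {p : ℂ} (hp : ‖p‖ < 1) :
    Tendsto (qPoch a p) atTop (𝓝 (qPochInf a p)) :=
  (multipliable_qPochInf a hp).hasProd.tendsto_prod_nat

theorem qPochInf_ne_zero {a p : ℂ} (ha : ‖a‖ < 1) (hp : ‖p‖ < 1) : qPochInf a p ≠ 0 := by
  have h : Summable fun j : ℕ => ‖-(a * p ^ j)‖ := by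
    simpa [norm_mul, norm_pow] using
      (summable_geometric_of_lt_one (norm_nonneg p) hp).mul_left ‖a‖
  have := tprod_one_add_ne_zero_of_summable (f := fun j : ℕ => -(a * p ^ j)) (fun j => by
    rw [← sub_eq_add_neg]
    refine one_sub_ne_zero_of_norm_lt_one ?_
    rw [norm_mul, norm_pow]
    exact mul_lt_one_of_nonneg_of_lt_one_left (norm_nonneg _) ha
      (pow_le_one₀ (norm_nonneg _) hp.le)) h
  simpa [qPochInf, sub_eq_add_neg] using this

theorem exists_norm_inv_qPoch_le {a p : ℂ} (ha : ‖a‖ < 1) (hp : ‖p‖ < 1) :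
    ∃ K : ℝ, 1 ≤ K ∧ ∀ n, ‖(qPoch a p n)⁻¹‖ ≤ K := by
  obtain ⟨K, hK⟩ := ((tendsto_qPoch a hp).inv₀ (qPochInf_ne_zero ha hp)).norm.bddAbove_range
  exact ⟨max K 1, le_max_right _ _, fun n => (hK ⟨n, rfl⟩).trans (le_max_left _ _)⟩

theorem exists_norm_recipPoch_le {p : ℂ} (hp : ‖p‖ < 1) :
    ∃ K : ℝ, 1 ≤ K ∧ ∀ m, ‖recipPoch p m‖ ≤ K := by
  obtain ⟨K, h1, hK⟩ := exists_norm_inv_qPoch_le hp hp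
  refine ⟨K, h1, fun m => ?_⟩
  rw [recipPoch]
  split_ifs
  · exact hK _
  · simpa using zero_le_one.trans h1

theorem tendsto_recipPoch {p : ℂ} (hp : ‖p‖ < 1) :
    Tendsto (recipPoch p) atTop (𝓝 (qPochInf p p)⁻¹) := by
  have h := ((tendsto_qPoch p hp).inv₀ (qPochInf_ne_zero hp hp)).comp
    (tendsto_atTop_atTop.mpr fun b => ⟨b, fun a ha => by omega⟩ :
      Tendsto Int.toNat atTop atTop)
  refine h.congr' ?_
  filter_upwards [eventually_ge_atTop 0] with m hm
  simp [recipPoch, hm]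

/-! ### Bilateral sums -/

/-- The bilateral sum `∑ w_r / ((p; p)_{A-r} (p; p)_{C+r})`, which has finitely many terms. -/
noncomputable def bilSum (p : ℂ) (w : ℤ → ℂ) (A C : ℤ) : ℂ :=
  ∑' r : ℤ, w r * (recipPoch p (A - r) * recipPoch p (C + r))

theorem summable_bilSum (p : ℂ) (w : ℤ → ℂ) (A C : ℤ) :
    Summable fun r : ℤ => w r * (recipPoch p (A - r) * recipPoch p (C + r)) := by
  refine summable_of_ne_finset_zero (s := Finset.Icc (-C) A) fun r hr => ?_
  rw [Finset.mem_Icc, not_and_or] at hr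
  rcases hr with h | h
  · rw [recipPoch_of_neg p (by omega : C + r < 0)]; ring
  · rw [recipPoch_of_neg p (by omega : A - r < 0)]; ring

theorem bilSum_zero_zero (p : ℂ) (w : ℤ → ℂ) : bilSum p w 0 0 = w 0 := by
  rw [bilSum, tsum_eq_single 0]
  · simp
  · intro r hr
    rcases lt_or_gt_of_ne hr with h | h
    · rw [recipPoch_of_neg p (by omega : 0 + r < 0)]; ring
    · rw [recipPoch_of_neg p (by omega : 0 - r < 0)]; ring

theorem tendsto_bilSum {p : ℂ} (hp : ‖p‖ < 1) {w : ℤ → ℂ} (hw : Summable fun r => ‖w r‖) :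
    Tendsto (fun N : ℕ => bilSum p w N N) atTop
      (𝓝 ((∑' r, w r) * ((qPochInf p p)⁻¹ * (qPochInf p p)⁻¹))) := by
  obtain ⟨K, hK1, hK⟩ := exists_norm_recipPoch_le hp
  rw [← tsum_mul_right]
  refine tendsto_tsum_of_dominated_convergence (hw.mul_right (K * K)) (fun r => ?_)
    (Eventually.of_forall fun N r => ?_)
  · refine Tendsto.const_mul _ (Tendsto.mul ?_ ?_)
    · exact (tendsto_recipPoch hp).comp (tendsto_atTop_add_const_right _ (-r)
        tendsto_natCast_atTop_atTop)
    · exact (tendsto_recipPoch hp).comp (tendsto_atTop_add_const_right _ r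
        tendsto_natCast_atTop_atTop)
  · rw [norm_mul, norm_mul]
    gcongr
    · exact hK _
    · exact hK _

/-! ### Theta weights and their reflections -/

/-- The triangular number `r (r - 1) / 2`. -/
def triangular (r : ℤ) : ℤ := r * (r - 1) / 2

theorem two_mul_triangular (r : ℤ) : 2 * triangular r = r * (r - 1) := by
  refine Int.mul_ediv_cancel' ?_
  have := Int.even_mul_pred_self r
  exact this.two_dvd

theorem triangular_add_one (r : ℤ) : triangular (r + 1) = triangular r + r := by
  have h1 := two_mul_triangular r
  have h2 := two_mul_triangular (r + 1)
  linarith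

theorem triangular_neg (r : ℤ) : triangular (-r) = triangular r + r := by
  have h1 := two_mul_triangular r
  have h2 := two_mul_triangular (-r)
  linarith

theorem triangular_one_sub (r : ℤ) : triangular (1 - r) = triangular r := by
  have h1 := two_mul_triangular r
  have h2 := two_mul_triangular (1 - r)
  linarith

theorem triangular_nonneg (r : ℤ) : 0 ≤ triangular r := by
  have h1 := two_mul_triangular r
  rcases le_or_gt r 0 with h | h <;> nlinarith

/-- The theta weight `(-1)^r s^{c r (r - 1) / 2 + j r}`. -/
noncomputable def thetaTerm (s : ℂ) (c j r : ℤ) : ℂ :=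
  (-1) ^ r * s ^ (c * triangular r + j * r)

theorem thetaTerm_zero (s : ℂ) (c j : ℤ) : thetaTerm s c j 0 = 1 := by
  simp [thetaTerm, triangular]

theorem neg_one_zpow_neg (r : ℤ) : (-1 : ℂ) ^ (-r) = (-1) ^ r := by
  rw [zpow_neg, ← inv_zpow]; norm_num

theorem thetaTerm_neg (s : ℂ) (c j r : ℤ) : thetaTerm s c j (-r) = thetaTerm s c (c - j) r := by
  rw [thetaTerm, thetaTerm, triangular_neg, neg_one_zpow_neg]
  congr 2; ring

theorem thetaTerm_mul_zpow {s : ℂ} (hs : s ≠ 0) (c j l r : ℤ) :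
    thetaTerm s c j r * s ^ (l * r) = thetaTerm s c (j + l) r := by
  rw [thetaTerm, thetaTerm, mul_assoc, ← zpow_add₀ hs]
  congr 2; ring

theorem thetaTerm_one_sub {s : ℂ} (hs : s ≠ 0) (c j r : ℤ) :
    thetaTerm s c j (1 - r) = -s ^ j * thetaTerm s c (-j) r := by
  rw [thetaTerm, thetaTerm, triangular_one_sub, sub_eq_add_neg, zpow_add₀ (by norm_num),
    neg_one_zpow_neg, show c * triangular r + j * (1 + -r) = j + (c * triangular r + -j * r) by ring,
    zpow_add₀ hs j]
  ring

theorem thetaTerm_add_one {s : ℂ} (hs : s ≠ 0) (c j r : ℤ) :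
    thetaTerm s c j (r + 1) = -s ^ (c * r + j) * thetaTerm s c j r := by
  rw [thetaTerm, thetaTerm, triangular_add_one, zpow_add₀ (by norm_num),
    show c * (triangular r + r) + j * (r + 1) = (c * r + j) + (c * triangular r + j * r) by ring,
    zpow_add₀ hs (c * r + j)]
  simp only [zpow_one]
  ring

/-- For r ≥ 0 the exponent is at least r because j ≥ 1; r → -r exchanges j with c - j, which is
positive too, so both halves are geometrically dominated. -/
theorem summable_norm_thetaTerm {s : ℂ} (hs1 : ‖s‖ < 1) {c j : ℤ} (hj : 0 < j)
    (hjc : j < c) : Summable fun r => ‖thetaTerm s c j r‖ := by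
  have key : ∀ c j : ℤ, 0 < j → j < c → ∀ n : ℕ, ‖thetaTerm s c j n‖ ≤ ‖s‖ ^ n := by
    intro c j hj hjc n
    have h0 : 0 ≤ triangular n := triangular_nonneg n
    have : thetaTerm s c j n = (-1) ^ (n : ℤ) * s ^ (c * triangular n + j * n).toNat := by
      rw [thetaTerm, ← zpow_natCast s, Int.toNat_of_nonneg (by nlinarith)]
    rw [this, norm_mul, norm_pow, norm_zpow]
    simp only [norm_neg, norm_one, one_zpow, one_mul]
    refine pow_le_pow_of_le_one (norm_nonneg _) hs1.le ?_
    have : (n : ℤ) ≤ c * triangular n + j * n := by nlinarith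
    omega
  have hg := summable_geometric_of_lt_one (norm_nonneg s) hs1
  refine Summable.of_nat_of_neg ?_ ?_
  · exact hg.of_nonneg_of_le (fun _ => norm_nonneg _) (key c j hj hjc)
  · simp only [thetaTerm_neg]
    exact hg.of_nonneg_of_le (fun _ => norm_nonneg _) (key c (c - j) (by omega) (by omega))

theorem bilSum_thetaTerm_neg (p s : ℂ) (c j A C : ℤ) :
    bilSum p (thetaTerm s c j) A C = bilSum p (thetaTerm s c (c - j)) C A := by
  rw [bilSum, bilSum, ← (Equiv.neg ℤ).tsum_eq]
  refine tsum_congr fun r => ?_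
  rw [Equiv.neg_apply, thetaTerm_neg, mul_comm (recipPoch p (A - -r))]
  congr 3
  ring

theorem bilSum_thetaTerm_one_sub (p : ℂ) {s : ℂ} (hs : s ≠ 0) (c j A C : ℤ) :
    bilSum p (thetaTerm s c j) A C =
      -s ^ j * bilSum p (thetaTerm s c (-j)) (C + 1) (A - 1) := by
  rw [bilSum, bilSum, ← (Equiv.subLeft (1 : ℤ)).tsum_eq, ← tsum_mul_left]
  refine tsum_congr fun r => ?_
  rw [Equiv.subLeft_apply, thetaTerm_one_sub hs, mul_comm (recipPoch p (A - (1 - r))), mul_assoc,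
    show C + (1 - r) = C + 1 - r by ring, show A - (1 - r) = A - 1 + r by ring]

/-! ### The Jacobi triple product -/

/-- Pascal's rule for the finite form of the triple product. -/
theorem bilSum_thetaTerm_triple_step {s : ℂ} (hs : s ≠ 0) (hs1 : ‖s‖ < 1) {c : ℕ} (hc : c ≠ 0)
    (j A C : ℤ) :
    (1 - (s ^ c) ^ (A + 1 + C)) * bilSum (s ^ c) (thetaTerm s c j) (A + 1) C =
      (1 - s ^ j * (s ^ c) ^ A) * bilSum (s ^ c) (thetaTerm s c j) A C := by
  have hp : ‖s ^ c‖ < 1 := norm_pow_lt_one hs1 hc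
  have hp0 : s ^ c ≠ 0 := pow_ne_zero _ hs
  set p := s ^ c with hpdef
  have hpz : ∀ n : ℤ, p ^ n = s ^ (c * n) := fun n => by
    rw [hpdef, ← zpow_natCast, ← zpow_mul]
  set w := thetaTerm s c j with hw
  have key : ∀ r, (1 - p ^ (A + 1 + C)) *
      (w r * (recipPoch p (A + 1 - r) * recipPoch p (C + r))) =
      w r * (recipPoch p (A - r) * recipPoch p (C + r)) +
        p ^ (A + 1 - r) * (w r * (recipPoch p (A + 1 - r) * recipPoch p (C - 1 + r))) := by
    intro r
    have e1 := recipPoch_sub_one hp (A + 1 - r)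
    have e2 := recipPoch_sub_one hp (C + r)
    have e3 : p ^ (A + 1 + C) = p ^ (A + 1 - r) * p ^ (C + r) := by
      rw [← zpow_add₀ hp0]; congr 1; ring
    rw [show A + 1 - r - 1 = A - r by ring] at e1
    rw [show C + r - 1 = C - 1 + r by ring] at e2
    rw [e1, e2, e3]
    ring
  have hsum : Summable fun r => p ^ (A + 1 - r) *
      (w r * (recipPoch p (A + 1 - r) * recipPoch p (C - 1 + r))) := by
    simpa only [mul_assoc] using
      summable_bilSum p (fun r => p ^ (A + 1 - r) * w r) (A + 1) (C - 1)
  rw [bilSum, ← tsum_mul_left, tsum_congr key, (summable_bilSum p w A C).tsum_add hsum,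
    ← (Equiv.addRight (1 : ℤ)).tsum_eq (fun r => p ^ (A + 1 - r) *
      (w r * (recipPoch p (A + 1 - r) * recipPoch p (C - 1 + r)))),
    sub_eq_add_neg 1 (s ^ j * p ^ A), add_mul, one_mul, bilSum, ← tsum_mul_left]
  congr 1
  refine tsum_congr fun r => ?_
  -- Because the base is s^c, the r-dependence of p^{A-r} cancels the factor s^{cr} gained by the
  -- theta weight.
  have e : p ^ (A + 1 - (r + 1)) * w (r + 1) = -(s ^ j * p ^ A) * w r := by
    rw [hw, thetaTerm_add_one hs, hpz, hpz, ← zpow_add₀ hs, ← mul_assoc, mul_neg, ← zpow_add₀ hs]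
    congr 3
    ring
  rw [Equiv.coe_addRight, ← mul_assoc, e, show A + 1 - (r + 1) = A - r by ring,
    show C - 1 + (r + 1) = C + r by ring, mul_assoc]

theorem bilSum_thetaTerm_mul_qPoch {s : ℂ} (hs : s ≠ 0) (hs1 : ‖s‖ < 1) {c : ℕ} (hc : c ≠ 0)
    (j : ℤ) (n m : ℕ) :
    bilSum (s ^ c) (thetaTerm s c j) n m * qPoch (s ^ c) (s ^ c) (n + m) =
      qPoch (s ^ j) (s ^ c) n *
        (bilSum (s ^ c) (thetaTerm s c j) 0 m * qPoch (s ^ c) (s ^ c) m) := by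
  induction n with
  | zero => simp [qPoch]
  | succ n ih =>
    have h := bilSum_thetaTerm_triple_step hs hs1 hc j n m
    rw [show n + 1 + m = n + m + 1 by ring, qPoch_succ, qPoch_succ,
      mul_right_comm _ _ (bilSum _ _ 0 _ * _), ← ih, ← pow_succ']
    push_cast
    rw [show (n : ℤ) + 1 + m = (n + m + 1 : ℕ) by push_cast; ring, zpow_natCast, zpow_natCast] at h
    linear_combination qPoch (s ^ c) (s ^ c) (n + m) * h

/-- Finite form of the Jacobi triple product. -/
theorem bilSum_thetaTerm_eq {s : ℂ} (hs : s ≠ 0) (hs1 : ‖s‖ < 1) {c : ℕ} (hc : c ≠ 0)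
    (j : ℤ) (n m : ℕ) :
    bilSum (s ^ c) (thetaTerm s c j) n m * qPoch (s ^ c) (s ^ c) (n + m) =
      qPoch (s ^ j) (s ^ c) n * qPoch (s ^ (c - j)) (s ^ c) m := by
  -- Reflection turns the remaining B(0, m) into B(m, 0) with j replaced by c - j, so the same
  -- recursion finishes.
  have h := bilSum_thetaTerm_mul_qPoch hs hs1 hc (c - j) m 0
  rw [bilSum_thetaTerm_mul_qPoch hs hs1 hc, bilSum_thetaTerm_neg]
  rw [Nat.cast_zero, bilSum_zero_zero, thetaTerm_zero] at h
  simp only [add_zero] at h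
  rw [h]
  simp [qPoch]

/-- The Jacobi triple product identity. -/
theorem tsum_thetaTerm {s : ℂ} (hs : s ≠ 0) (hs1 : ‖s‖ < 1) {c j : ℕ} (hj : 0 < j)
    (hjc : j < c) :
    ∑' r, thetaTerm s c j r =
      qPochInf (s ^ j) (s ^ c) * qPochInf (s ^ (c - j)) (s ^ c) * qPochInf (s ^ c) (s ^ c) := by
  have hc : c ≠ 0 := by omega
  have hp : ‖s ^ c‖ < 1 := norm_pow_lt_one hs1 hc
  have h0 := qPochInf_ne_zero hp hp
  have h1 := (tendsto_bilSum hp (summable_norm_thetaTerm hs1 (c := c) (j := j)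
    (by omega) (by omega))).mul ((tendsto_qPoch (s ^ c) hp).comp
      (tendsto_atTop_mono (fun n : ℕ => (by omega : n ≤ n + n)) tendsto_id))
  have h2 := (tendsto_qPoch (s ^ j) hp).mul (tendsto_qPoch (s ^ (c - j)) hp)
  have h3 := tendsto_nhds_unique (h1.congr fun n => ?_) h2
  · rw [← h3]
    field_simp
  · have := bilSum_thetaTerm_eq hs hs1 hc j n n
    rw [← Nat.cast_sub hjc.le, zpow_natCast, zpow_natCast] at this
    exact this

/-! ### Contiguous relations and the seed Bailey pair -/

/-- Lowering A inserts the factor 1 - q^{A+1-r}, and q^{-r} = s^{-2r} is absorbed by the weight as j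
→ j - 2. -/
theorem bilSum_thetaTerm_lower_left {s : ℂ} (hs : s ≠ 0) (hs1 : ‖s‖ < 1) (c j A C : ℤ) :
    bilSum (s ^ 2) (thetaTerm s c j) A C = bilSum (s ^ 2) (thetaTerm s c j) (A + 1) C -
      s ^ (2 * A + 2) * bilSum (s ^ 2) (thetaTerm s c (j - 2)) (A + 1) C := by
  have hq : ‖s ^ 2‖ < 1 := norm_pow_lt_one hs1 two_ne_zero
  rw [bilSum, bilSum, bilSum, ← tsum_mul_left, ← (summable_bilSum _ _ _ _).tsum_sub
    ((summable_bilSum _ _ _ _).mul_left _)]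
  refine tsum_congr fun r => ?_
  have e := recipPoch_sub_one hq (A + 1 - r)
  have e2 : (s ^ 2) ^ (A + 1 - r) = s ^ (2 * A + 2) * s ^ (-2 * r) := by
    rw [← zpow_natCast, ← zpow_mul, ← zpow_add₀ hs]; congr 1; push_cast; ring
  rw [show A + 1 - r - 1 = A - r by ring, e2] at e
  rw [e, sub_eq_add_neg j, ← thetaTerm_mul_zpow hs c j (-2) r]
  ring

theorem bilSum_thetaTerm_lower_right {s : ℂ} (hs : s ≠ 0) (hs1 : ‖s‖ < 1) (c j A C : ℤ) :
    bilSum (s ^ 2) (thetaTerm s c j) A C = bilSum (s ^ 2) (thetaTerm s c j) A (C + 1) -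
      s ^ (2 * C + 2) * bilSum (s ^ 2) (thetaTerm s c (j + 2)) A (C + 1) := by
  rw [bilSum_thetaTerm_neg, bilSum_thetaTerm_lower_left hs hs1, bilSum_thetaTerm_neg,
    bilSum_thetaTerm_neg _ _ _ (c - j - 2)]
  congr 4 <;> ring_nf

/-- The reflection r → 1 - r fixes the denominators and reverses the sign, so the sum is its own
negative. -/
theorem bilSum_thetaTerm_zero (p : ℂ) {s : ℂ} (hs : s ≠ 0) (c N : ℤ) :
    bilSum p (thetaTerm s c 0) (N + 1) N = 0 := by
  have h := bilSum_thetaTerm_one_sub p hs c 0 (N + 1) N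
  rw [zpow_zero, neg_zero, show N + 1 - 1 = N by ring] at h
  linear_combination h / 2

/-- Passage between the Bailey pairs relative to `1` and to `q`. -/
theorem bilSum_thetaTerm_two {s : ℂ} (hs : s ≠ 0) (hs1 : ‖s‖ < 1) (c N : ℤ) :
    bilSum (s ^ 2) (thetaTerm s c 2) N N = bilSum (s ^ 2) (thetaTerm s c 2) (N + 1) N := by
  rw [bilSum_thetaTerm_lower_left hs hs1, sub_self, bilSum_thetaTerm_zero _ hs]
  ring

/-- For c = 3 the reflection r → -r swaps j = 1 with 2 and j = 0 with 3, so the contiguous relations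
close up. Going from (N,N) to (N+1,N) gives the factor 1 + s^{2N+1}; going on to (N+1,N+1) gives 1 -
s^{4N+4}. -/
theorem bilSum_thetaTerm_three_succ {s : ℂ} (hs : s ≠ 0) (hs1 : ‖s‖ < 1) (N : ℤ) :
    bilSum (s ^ 2) (thetaTerm s 3 2) N N =
      (1 + s ^ (2 * N + 1)) * (1 - s ^ (4 * N + 4)) *
        bilSum (s ^ 2) (thetaTerm s 3 2) (N + 1) (N + 1) := by
  have a1 := bilSum_thetaTerm_neg (s ^ 2) s 3 2 N N
  have a2 := bilSum_thetaTerm_lower_left hs hs1 3 1 N N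
  have a3 := bilSum_thetaTerm_one_sub (s ^ 2) hs 3 1 (N + 1) N
  have a4 := bilSum_thetaTerm_lower_right hs hs1 3 1 (N + 1) N
  have a5 := bilSum_thetaTerm_neg (s ^ 2) s 3 3 (N + 1) (N + 1)
  have a6 := bilSum_thetaTerm_lower_right hs hs1 3 0 (N + 1) N
  have a7 := bilSum_thetaTerm_neg (s ^ 2) s 3 2 (N + 1) (N + 1)
  rw [bilSum_thetaTerm_zero _ hs] at a6
  norm_num at a1 a2 a3 a4 a5 a6 a7
  have z1 : s ^ (2 * N + 2) = s ^ (2 * N + 1) * s := by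
    rw [← zpow_add_one₀ hs]; congr 1; ring
  have z2 : s ^ (4 * N + 4) = s ^ (2 * N + 2) * s ^ (2 * N + 2) := by
    rw [← zpow_add₀ hs]; congr 1; ring
  have b1 : bilSum (s ^ 2) (thetaTerm s 3 1) N N =
      (1 + s ^ (2 * N + 1)) * bilSum (s ^ 2) (thetaTerm s 3 1) (N + 1) N := by
    rw [a2, z1]
    linear_combination (-s ^ (2 * N + 1)) * a3
  have b2 : bilSum (s ^ 2) (thetaTerm s 3 1) (N + 1) N =
      (1 - s ^ (4 * N + 4)) * bilSum (s ^ 2) (thetaTerm s 3 1) (N + 1) (N + 1) := by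
    rw [a4, a5, z2]
    linear_combination s ^ (2 * N + 2) * a6 - s ^ (2 * N + 2) * s ^ (2 * N + 2) * a7
  rw [a1, b1, b2, a7]
  ring

/-- The Bailey pair whose `β_N` is `1 / ((-q^{1/2}; q)_N (q²; q²)_N)`. -/
theorem bilSum_thetaTerm_three {s : ℂ} (hs : s ≠ 0) (hs1 : ‖s‖ < 1) (N : ℕ) :
    bilSum (s ^ 2) (thetaTerm s 3 2) N N =
      (qPoch (-s) (s ^ 2) N * qPoch ((s ^ 2) ^ 2) ((s ^ 2) ^ 2) N)⁻¹ := by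
  have hq : ‖s ^ 2‖ < 1 := norm_pow_lt_one hs1 two_ne_zero
  have hq2 : ‖(s ^ 2) ^ 2‖ < 1 := norm_pow_lt_one hq two_ne_zero
  have hs' : ‖-s‖ < 1 := by rwa [norm_neg]
  induction N with
  | zero => simp [bilSum_zero_zero, thetaTerm_zero, qPoch]
  | succ N ih =>
    have h := bilSum_thetaTerm_three_succ hs hs1 N
    have n1 := qPoch_ne_zero hs' hq (N + 1)
    have n2 := qPoch_ne_zero hq2 hq2 (N + 1)
    rw [ih] at h
    rw [qPoch_succ] at n1 n2
    rw [qPoch_succ, qPoch_succ]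
    push_cast
    have z1 : s ^ (2 * (N : ℤ) + 1) = s * (s ^ 2) ^ N := by
      rw [show 2 * (N : ℤ) + 1 = (2 * N + 1 : ℕ) by push_cast; ring, zpow_natCast]; ring
    have z2 : s ^ (4 * (N : ℤ) + 4) = (s ^ 2) ^ 2 * ((s ^ 2) ^ 2) ^ N := by
      rw [show 4 * (N : ℤ) + 4 = (4 * N + 4 : ℕ) by push_cast; ring, zpow_natCast]; ring
    rw [z1, z2] at h
    obtain ⟨m1, m2⟩ := mul_ne_zero_iff.mp n1
    obtain ⟨m3, m4⟩ := mul_ne_zero_iff.mp n2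
    rw [show 1 + s * (s ^ 2) ^ N = 1 - -s * (s ^ 2) ^ N by ring] at h
    refine eq_inv_of_mul_eq_one_left ?_
    have h' : qPoch (-s) (s ^ 2) N * qPoch ((s ^ 2) ^ 2) ((s ^ 2) ^ 2) N *
      (qPoch (-s) (s ^ 2) N * qPoch ((s ^ 2) ^ 2) ((s ^ 2) ^ 2) N)⁻¹ = 1 :=
      mul_inv_cancel₀ (mul_ne_zero m1 m3)
    rw [h] at h'
    linear_combination h'

/-! ### The Bailey steps -/

theorem sum_mul_bilSum {q : ℂ} (w w' : ℤ → ℂ) (f : ℕ → ℂ) (N : ℕ) (d : ℤ)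
    (h : ∀ r, ∑ M ∈ Finset.range (N + 1), f M *
      (recipPoch q (M + d - r) * recipPoch q (M + r)) * w r =
        w' r * (recipPoch q (N + d - r) * recipPoch q (N + r))) :
    ∑ M ∈ Finset.range (N + 1), f M * bilSum q w (M + d) M = bilSum q w' (N + d) N := by
  simp only [bilSum, ← tsum_mul_left]
  rw [← Summable.tsum_finsetSum fun (M : ℕ) _ =>
    (summable_bilSum q w ((M : ℤ) + d) M).mul_left (f M)]
  refine tsum_congr fun r => ?_
  rw [← h r]
  exact Finset.sum_congr rfl fun M _ => by ring

/-- The Bailey step relative to `a = 1`. -/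
theorem sum_bilSum_thetaTerm {s : ℂ} (hs : s ≠ 0) (hs1 : ‖s‖ < 1) (c j : ℤ) (N : ℕ) :
    ∑ M ∈ Finset.range (N + 1), ((s ^ 2) ^ (M ^ 2) * recipPoch (s ^ 2) ((N : ℤ) - M)) *
      bilSum (s ^ 2) (thetaTerm s c j) M M =
        bilSum (s ^ 2) (thetaTerm s (c + 4) (j + 2)) N N := by
  have hq : ‖s ^ 2‖ < 1 := norm_pow_lt_one hs1 two_ne_zero
  have := sum_mul_bilSum (q := s ^ 2) (thetaTerm s c j) (thetaTerm s (c + 4) (j + 2))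
    (fun M => (s ^ 2) ^ (M ^ 2) * recipPoch (s ^ 2) ((N : ℤ) - M)) N 0 fun r => ?_
  · simpa using this
  · have h := sum_bailey_kernel hq (pow_ne_zero 2 hs) zero_le_one N r
    simp only [zero_mul, add_zero] at h ⊢
    -- q^{r²} = s^{4 r(r-1)/2 + 2r}, hence c + 4 and j + 2.
    have e : (s ^ 2) ^ (r ^ 2) * thetaTerm s c j r = thetaTerm s (c + 4) (j + 2) r := by
      have := two_mul_triangular r
      rw [thetaTerm, thetaTerm, mul_left_comm, ← zpow_natCast s 2, ← zpow_mul, ← zpow_add₀ hs]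
      congr 2
      push_cast
      linear_combination (-2) * this
    rw [← Finset.sum_mul, ← e, mul_right_comm, ← h]
    exact_mod_cast rfl

/-- The Bailey step relative to `a = q`. -/
theorem sum_bilSum_thetaTerm_two {s : ℂ} (hs : s ≠ 0) (hs1 : ‖s‖ < 1) (c : ℤ) (N : ℕ) :
    ∑ M ∈ Finset.range (N + 1), ((s ^ 2) ^ (M ^ 2 + M) * recipPoch (s ^ 2) ((N : ℤ) - M)) *
      bilSum (s ^ 2) (thetaTerm s c 2) M M =
        bilSum (s ^ 2) (thetaTerm s (c + 4) 2) N N := by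
  have hq : ‖s ^ 2‖ < 1 := norm_pow_lt_one hs1 two_ne_zero
  simp only [bilSum_thetaTerm_two hs hs1]
  refine sum_mul_bilSum (q := s ^ 2) (thetaTerm s c 2) (thetaTerm s (c + 4) 2)
    (fun M => (s ^ 2) ^ (M ^ 2 + M) * recipPoch (s ^ 2) ((N : ℤ) - M)) N 1 fun r => ?_
  -- At -r the kernel has the denominators of B(N+1, N), and its exponent r² - r = 2 · r(r-1)/2
  -- changes only c.
  have h := sum_bailey_kernel hq (pow_ne_zero 2 hs) le_rfl N (-r)
  have e : (s ^ 2) ^ ((-r) ^ 2 + 1 * -r) * thetaTerm s c 2 r = thetaTerm s (c + 4) 2 r := by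
    have := two_mul_triangular r
    rw [thetaTerm, thetaTerm, mul_left_comm, ← zpow_natCast s 2, ← zpow_mul, ← zpow_add₀ hs]
    congr 2
    push_cast
    linear_combination (-2) * this
  have e2 : ∀ n : ℤ, recipPoch (s ^ 2) (n - -r) * recipPoch (s ^ 2) (n + -r + 1) =
      recipPoch (s ^ 2) (n + 1 - r) * recipPoch (s ^ 2) (n + r) := by
    intro n
    rw [mul_comm]
    congr 2 <;> ring
  simp only [e2, one_mul] at h e
  rw [← Finset.sum_mul, ← e, mul_right_comm, ← h]
  exact_mod_cast rfl

/-! ### Prepending an outermost summation variable -/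

theorem sum_Icc_one_succ {α : Type*} [AddCommMonoid α] (f : ℕ → α) (k : ℕ) :
    ∑ j ∈ Finset.Icc 1 (k + 1), f j = f 1 + ∑ j ∈ Finset.Icc 1 k, f (j + 1) := by
  induction k with
  | zero => simp
  | succ k ih =>
    rw [Finset.sum_Icc_succ_top (by omega), ih, Finset.sum_Icc_succ_top (by omega), add_assoc]

theorem prod_Icc_one_succ {α : Type*} [CommMonoid α] (f : ℕ → α) (k : ℕ) :
    ∏ j ∈ Finset.Icc 1 (k + 1), f j = f 1 * ∏ j ∈ Finset.Icc 1 k, f (j + 1) := by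
  induction k with
  | zero => simp
  | succ k ih =>
    rw [Finset.prod_Icc_succ_top (by omega), ih, Finset.prod_Icc_succ_top (by omega), mul_assoc]

theorem sum_Icc_succ_succ (f : ℕ → ℕ) (j k : ℕ) :
    ∑ l ∈ Finset.Icc (j + 1) (k + 1), f l = ∑ l ∈ Finset.Icc j k, f (l + 1) := by
  rw [← Finset.map_add_right_Icc, Finset.sum_map]
  rfl

theorem consEquiv_eq_cons {k : ℕ} (x : ℕ × (Fin k → ℕ)) :
    Fin.consEquiv (fun _ : Fin (k + 1) => ℕ) x = (Fin.cons x.1 x.2 : Fin (k + 1) → ℕ) :=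
  rfl

theorem entry_cons_one {k : ℕ} (a : ℕ) (n : Fin k → ℕ) :
    entry (Fin.cons a n : Fin (k + 1) → ℕ) 1 = a := by
  simp [entry]

theorem entry_cons_succ {k : ℕ} (a : ℕ) (n : Fin k → ℕ) {j : ℕ} (hj : 1 ≤ j) :
    entry (Fin.cons a n : Fin (k + 1) → ℕ) (j + 1) = entry n j := by
  obtain ⟨j, rfl⟩ := Nat.exists_eq_add_of_le' hj
  by_cases h : j + 1 ≤ k
  · simp only [entry]
    rw [dif_pos (by omega), dif_pos (by omega)]
    exact Fin.cons_succ (α := fun _ => ℕ) a n ⟨j, by omega⟩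
  · simp only [entry]
    rw [dif_neg (by omega), dif_neg (by omega)]

theorem tailSum_cons_one {k : ℕ} (a : ℕ) (n : Fin k → ℕ) :
    tailSum (Fin.cons a n : Fin (k + 1) → ℕ) 1 = a + tailSum n 1 := by
  rw [tailSum, sum_Icc_one_succ, entry_cons_one, tailSum]
  congr 1
  exact Finset.sum_congr rfl fun l hl => entry_cons_succ a n (Finset.mem_Icc.mp hl).1

theorem tailSum_cons_succ {k : ℕ} (a : ℕ) (n : Fin k → ℕ) {j : ℕ} (hj : 1 ≤ j) :
    tailSum (Fin.cons a n : Fin (k + 1) → ℕ) (j + 1) = tailSum n j := by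
  rw [tailSum, sum_Icc_succ_succ, tailSum]
  exact Finset.sum_congr rfl fun l hl =>
    entry_cons_succ a n (hj.trans (Finset.mem_Icc.mp hl).1)

theorem sum_tailSum_sq_cons {k : ℕ} (a : ℕ) (n : Fin k → ℕ) :
    ∑ j ∈ Finset.Icc 1 (k + 1), tailSum (Fin.cons a n : Fin (k + 1) → ℕ) j ^ 2 =
      (a + tailSum n 1) ^ 2 + ∑ j ∈ Finset.Icc 1 k, tailSum n j ^ 2 := by
  rw [sum_Icc_one_succ, tailSum_cons_one]
  congr 1
  exact Finset.sum_congr rfl fun l hl => by rw [tailSum_cons_succ a n (Finset.mem_Icc.mp hl).1]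

theorem sumExponent_one_cons {k : ℕ} (a : ℕ) (n : Fin k → ℕ) :
    sumExponent 1 (Fin.cons a n : Fin (k + 1) → ℕ) =
      ((a + tailSum n 1) ^ 2 + (a + tailSum n 1)) + sumExponent 1 n := by
  have h : ∑ j ∈ Finset.Icc 1 (k + 1), tailSum (Fin.cons a n : Fin (k + 1) → ℕ) j =
      (a + tailSum n 1) + ∑ j ∈ Finset.Icc 1 k, tailSum n j := by
    rw [sum_Icc_one_succ, tailSum_cons_one]
    congr 1
    exact Finset.sum_congr rfl fun l hl => tailSum_cons_succ a n (Finset.mem_Icc.mp hl).1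
  rw [sumExponent, sum_tailSum_sq_cons, h, sumExponent]
  ring

theorem sumExponent_succ_cons {k i : ℕ} (hi : 1 ≤ i) (a : ℕ) (n : Fin k → ℕ) :
    sumExponent (i + 1) (Fin.cons a n : Fin (k + 1) → ℕ) =
      (a + tailSum n 1) ^ 2 + sumExponent i n := by
  rw [sumExponent, sum_tailSum_sq_cons, sum_Icc_succ_succ, sumExponent, add_assoc]
  congr 2
  exact Finset.sum_congr rfl fun l hl =>
    tailSum_cons_succ a n (hi.trans (Finset.mem_Icc.mp hl).1)

theorem sumDenominator_cons {k : ℕ} (q s : ℂ) (a : ℕ) (n : Fin (k + 1) → ℕ) :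
    sumDenominator q s (Fin.cons a n : Fin (k + 1 + 1) → ℕ) =
      qPoch q q a * sumDenominator q s n := by
  simp only [sumDenominator, Nat.add_sub_cancel]
  rw [prod_Icc_one_succ, entry_cons_one, entry_cons_succ a n (by omega : 1 ≤ k + 1),
    Finset.prod_congr rfl fun l hl => by rw [entry_cons_succ a n (Finset.mem_Icc.mp hl).1]]
  ring

/-! ### The finite multisum identity -/

/-- The inductive step for a sum over nested tail sums, `M = a + ν n` being the new outermost
tail sum. -/
theorem hasSum_nested {X : Type*} (q : ℂ) (T : X → ℂ) (ν : X → ℕ) (f V : ℕ → ℂ)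
    (h : ∀ M : ℕ, HasSum (fun n => T n * recipPoch q ((M : ℤ) - ν n)) (V M)) (N : ℕ) :
    HasSum (fun x : ℕ × X => f (x.1 + ν x.2) * (recipPoch q x.1 * T x.2) *
        recipPoch q ((N : ℤ) - (x.1 + ν x.2 : ℕ)))
      (∑ M ∈ Finset.range (N + 1), (f M * recipPoch q ((N : ℤ) - M)) * V M) := by
  -- In the coordinates (M, n) the summand is supported on ν n ≤ M ≤ N, the reciprocals being zero
  -- elsewhere; the injection (a, n) ↦ (a + ν n, n) covers this support.
  let φ : ℕ × X → ℂ := fun x => (f x.1 * recipPoch q ((N : ℤ) - x.1)) *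
    (T x.2 * recipPoch q ((x.1 : ℤ) - ν x.2))
  have hφ : HasSum φ (∑ M ∈ Finset.range (N + 1), (f M * recipPoch q ((N : ℤ) - M)) * V M) := by
    have h1 : ∀ M : ℕ, HasSum (fun x : ℕ × X => if x.1 = M then φ x else 0)
        ((f M * recipPoch q ((N : ℤ) - M)) * V M) := by
      intro M
      have hinj : Function.Injective fun n : X => (M, n) := fun _ _ h => (Prod.mk.inj h).2
      refine (hinj.hasSum_iff ?_).mp ?_
      · rintro ⟨M', n⟩ hx
        refine if_neg ?_
        rintro rfl
        exact hx ⟨n, rfl⟩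
      · simpa [φ, Function.comp_def] using (h M).mul_left (f M * recipPoch q ((N : ℤ) - M))
    refine (hasSum_sum fun M (_ : M ∈ Finset.range (N + 1)) => h1 M).congr_fun ?_
    rintro ⟨M, n⟩
    rw [Finset.sum_ite_eq]
    split_ifs with hM
    · rfl
    · rw [Finset.mem_range] at hM
      simp only [φ]
      rw [recipPoch_of_neg q (by omega : (N : ℤ) - M < 0)]
      ring
  have hinj : Function.Injective fun x : ℕ × X => (x.1 + ν x.2, x.2) := by
    rintro ⟨a, n⟩ ⟨b, m⟩ hab
    simp only [Prod.mk.injEq] at hab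
    obtain ⟨h1, rfl⟩ := hab
    simpa using h1
  convert (hinj.hasSum_iff ?_).mpr hφ using 1
  · funext x
    simp only [φ, Function.comp_apply]
    rw [show ((x.1 + ν x.2 : ℕ) : ℤ) - ν x.2 = x.1 by push_cast; ring]
    ring
  · rintro ⟨M, n⟩ hx
    have hM : M < ν n := by
      by_contra hM
      exact hx ⟨(M - ν n, n), by simp; omega⟩
    simp only [φ]
    rw [recipPoch_of_neg q (by omega : (M : ℤ) - ν n < 0)]
    ring

theorem hasSum_fin_one_iff {f : (Fin 1 → ℕ) → ℂ} {x : ℂ} :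
    HasSum f x ↔ HasSum (fun m : ℕ => f fun _ => m) x :=
  ((Equiv.funUnique (Fin 1) ℕ).symm.hasSum_iff (f := f)).symm

/-- The finite form of the multisum identity. -/
theorem hasSum_multisum_finite {s : ℂ} (hs : s ≠ 0) (hs1 : ‖s‖ < 1) (k : ℕ) :
    ∀ i : ℕ, 1 ≤ i → i ≤ k + 2 → ∀ N : ℕ,
      HasSum (fun n : Fin (k + 1) → ℕ => (s ^ 2) ^ sumExponent i n / sumDenominator (s ^ 2) s n *
          recipPoch (s ^ 2) ((N : ℤ) - tailSum n 1))
        (bilSum (s ^ 2) (thetaTerm s (4 * k + 7) (2 * i)) N N) := by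
  induction k with
  | zero =>
    intro i hi hi2 N
    rw [hasSum_fin_one_iff]
    have hν : ∀ m : ℕ, tailSum (fun _ : Fin 1 => m) 1 = m := fun m => by simp [tailSum, entry]
    have hden : ∀ m : ℕ, (sumDenominator (s ^ 2) s (fun _ : Fin 1 => m))⁻¹ =
        bilSum (s ^ 2) (thetaTerm s 3 2) m m := fun m => by
      rw [bilSum_thetaTerm_three hs hs1]
      simp [sumDenominator, entry]
    simp only [hν, div_eq_mul_inv, hden]
    have base : ∀ e : ℕ → ℕ, HasSum (fun m : ℕ => (s ^ 2) ^ e m *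
        bilSum (s ^ 2) (thetaTerm s 3 2) m m * recipPoch (s ^ 2) ((N : ℤ) - m))
        (∑ M ∈ Finset.range (N + 1), ((s ^ 2) ^ e M * recipPoch (s ^ 2) ((N : ℤ) - M)) *
          bilSum (s ^ 2) (thetaTerm s 3 2) M M) := by
      intro e
      rw [Finset.sum_congr rfl fun M _ => mul_right_comm _ _ _]
      refine hasSum_sum_of_ne_finset_zero fun m hm => ?_
      rw [Finset.mem_range] at hm
      rw [recipPoch_of_neg _ (by omega : (N : ℤ) - m < 0), mul_zero]
    obtain rfl | rfl : i = 1 ∨ i = 2 := by omega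
    · have := base fun m => m ^ 2 + m
      rw [sum_bilSum_thetaTerm_two hs hs1] at this
      simpa [sumExponent, hν] using this
    · have := base fun m => m ^ 2
      rw [sum_bilSum_thetaTerm hs hs1] at this
      simpa [sumExponent, hν] using this
  | succ k ih =>
    intro i hi hi2 N
    rw [← (Fin.consEquiv fun _ : Fin (k + 2) => ℕ).hasSum_iff]
    -- For i = 1 the new outermost sum has a linear term and the inner sum again has i = 1;
    -- otherwise it has none and the inner index is i - 1.
    rcases Nat.eq_or_lt_of_le hi with rfl | hi'
    · have h := hasSum_nested (s ^ 2) _ _ (fun M => (s ^ 2) ^ (M ^ 2 + M)) _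
        (ih 1 le_rfl (by omega)) N
      simp only [Nat.cast_one, mul_one] at h ⊢
      rw [sum_bilSum_thetaTerm_two hs hs1] at h
      convert h using 1
      · funext x
        simp only [Function.comp_apply, consEquiv_eq_cons]
        rw [sumExponent_one_cons, sumDenominator_cons, tailSum_cons_one, recipPoch_natCast,
          pow_add (s ^ 2) (_ + _) (sumExponent 1 x.2)]
        ring
      · rw [show 4 * ((k + 1 : ℕ) : ℤ) + 7 = 4 * k + 7 + 4 by push_cast; ring]
    · obtain ⟨j, rfl⟩ := Nat.exists_eq_add_of_le' hi
      have hj : 1 ≤ j := by omega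
      have h := hasSum_nested (s ^ 2) _ _ (fun M => (s ^ 2) ^ (M ^ 2)) _
        (ih j hj (by omega)) N
      rw [sum_bilSum_thetaTerm hs hs1] at h
      convert h using 1
      · funext x
        simp only [Function.comp_apply, consEquiv_eq_cons]
        rw [sumExponent_succ_cons hj, sumDenominator_cons, tailSum_cons_one, recipPoch_natCast,
          pow_add (s ^ 2) _ (sumExponent j x.2)]
        ring
      · rw [show 4 * ((k + 1 : ℕ) : ℤ) + 7 = 4 * k + 7 + 4 by push_cast; ring,
          show 2 * ((j + 1 : ℕ) : ℤ) = 2 * j + 2 by push_cast; ring]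

/-! ### Absolute convergence and the limit N → ∞ -/

theorem summable_pow_tailSum {ρ : ℝ} (h0 : 0 ≤ ρ) (h1 : ρ < 1) (k : ℕ) :
    Summable fun n : Fin k → ℕ => ρ ^ tailSum n 1 := by
  induction k with
  | zero => exact Summable.of_finite
  | succ k ih =>
    rw [← (Fin.consEquiv fun _ : Fin (k + 1) => ℕ).summable_iff]
    convert (summable_geometric_of_lt_one h0 h1).mul_of_nonneg ih (fun n => pow_nonneg h0 n)
      (fun n => pow_nonneg h0 _) using 1
    funext x
    simp only [Function.comp_apply, consEquiv_eq_cons]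
    rw [tailSum_cons_one, pow_add]

theorem tailSum_one_le_sumExponent {k : ℕ} (hk : 1 ≤ k) (i : ℕ) (n : Fin k → ℕ) :
    tailSum n 1 ≤ sumExponent i n := by
  refine le_trans ?_ (Nat.le_add_right _ _)
  refine le_trans ?_ (Finset.single_le_sum (f := fun j => tailSum n j ^ 2)
    (fun _ _ => Nat.zero_le _) (Finset.mem_Icc.mpr ⟨le_rfl, hk⟩))
  exact Nat.le_self_pow two_ne_zero _

theorem exists_norm_inv_sumDenominator_le {q s : ℂ} (hq : ‖q‖ < 1) (hs : ‖s‖ < 1) (k : ℕ) :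
    ∃ K : ℝ, ∀ n : Fin k → ℕ, ‖(sumDenominator q s n)⁻¹‖ ≤ K := by
  have hq2 : ‖q ^ 2‖ < 1 := norm_pow_lt_one hq two_ne_zero
  obtain ⟨K₁, h₁, hK₁⟩ := exists_norm_inv_qPoch_le hq hq
  obtain ⟨K₂, h₂, hK₂⟩ := exists_norm_inv_qPoch_le (a := -s) (by rwa [norm_neg]) hq
  obtain ⟨K₃, h₃, hK₃⟩ := exists_norm_inv_qPoch_le hq2 hq2
  refine ⟨(∏ _j ∈ Finset.Icc 1 (k - 1), K₁) * K₂ * K₃, fun n => ?_⟩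
  rw [sumDenominator, mul_inv, mul_inv, norm_mul, norm_mul, ← Finset.prod_inv_distrib, norm_prod]
  have : 0 ≤ ∏ _j ∈ Finset.Icc 1 (k - 1), K₁ := Finset.prod_nonneg fun _ _ => by linarith
  gcongr
  · exact hK₁ _
  · exact hK₂ _
  · exact hK₃ _

theorem summable_norm_multisum {q s : ℂ} (hq : ‖q‖ < 1) (hs : ‖s‖ < 1) {k : ℕ} (hk : 1 ≤ k)
    (i : ℕ) :
    Summable fun n : Fin k → ℕ => ‖q ^ sumExponent i n / sumDenominator q s n‖ := by
  obtain ⟨K, hK⟩ := exists_norm_inv_sumDenominator_le hq hs k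
  refine ((summable_pow_tailSum (norm_nonneg q) hq k).mul_right K).of_nonneg_of_le
    (fun _ => norm_nonneg _) fun n => ?_
  rw [div_eq_mul_inv, norm_mul, norm_pow]
  exact mul_le_mul (pow_le_pow_of_le_one (norm_nonneg _) hq.le (tailSum_one_le_sumExponent hk i n))
    (hK n) (norm_nonneg _) (pow_nonneg (norm_nonneg _) _)

/-- Dominated convergence applies on both sides of the finite identity: the left gains 1/(q;q)_∞,
the right its square. -/
theorem tsum_multisum {s : ℂ} (hs : s ≠ 0) (hs1 : ‖s‖ < 1) (k i : ℕ) (hi : 1 ≤ i)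
    (hik : i ≤ k + 2) :
    ∑' n : Fin (k + 1) → ℕ, (s ^ 2) ^ sumExponent i n / sumDenominator (s ^ 2) s n =
      (∑' r, thetaTerm s (4 * k + 7) (2 * i) r) / qPochInf (s ^ 2) (s ^ 2) := by
  have hq : ‖s ^ 2‖ < 1 := norm_pow_lt_one hs1 two_ne_zero
  have hsum := summable_norm_multisum hq hs1 (Nat.le_add_left 1 k) i
  obtain ⟨K, -, hK⟩ := exists_norm_recipPoch_le hq
  have h1 : Tendsto (fun N : ℕ => ∑' n : Fin (k + 1) → ℕ, (s ^ 2) ^ sumExponent i n /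
      sumDenominator (s ^ 2) s n * recipPoch (s ^ 2) ((N : ℤ) - tailSum n 1)) atTop
      (𝓝 (∑' n : Fin (k + 1) → ℕ, (s ^ 2) ^ sumExponent i n / sumDenominator (s ^ 2) s n *
        (qPochInf (s ^ 2) (s ^ 2))⁻¹)) := by
    refine tendsto_tsum_of_dominated_convergence (hsum.mul_right K) (fun n => ?_)
      (Eventually.of_forall fun N n => ?_)
    · exact ((tendsto_recipPoch hq).comp (tendsto_atTop_add_const_right _ (-(tailSum n 1 : ℤ))
        tendsto_natCast_atTop_atTop)).const_mul _
    · rw [norm_mul]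
      exact mul_le_mul_of_nonneg_left (hK _) (norm_nonneg _)
  have h2 := tendsto_bilSum hq (summable_norm_thetaTerm hs1 (c := 4 * k + 7) (j := 2 * i)
    (by omega) (by omega))
  have h3 := tendsto_nhds_unique
    (h1.congr fun N => (hasSum_multisum_finite hs hs1 k i hi hik N).tsum_eq) h2
  have h0 := qPochInf_ne_zero hq hq
  rw [tsum_mul_right, ← mul_assoc] at h3
  rw [mul_right_cancel₀ (inv_ne_zero h0) h3, div_eq_mul_inv]

/-! ### The product formula -/

theorem tailSum_one_eq_zero {k : ℕ} {n : Fin k → ℕ} (h : tailSum n 1 = 0) : n = 0 := by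
  funext j
  have := Finset.sum_eq_zero_iff.mp h (j + 1) (Finset.mem_Icc.mpr ⟨by omega, by omega⟩)
  rw [entry, dif_pos (by omega)] at this
  simpa using this

theorem qPochInf_zero_left (p : ℂ) : qPochInf 0 p = 1 := by
  simp [qPochInf]

theorem theorem1p1 (k i : ℕ) (hk : 1 ≤ k) (hi : 1 ≤ i) (hik : i ≤ k + 1)
    (q s : ℂ) (hq : ‖q‖ < 1) (hs : s ^ 2 = q) :
    HasSum (fun n : Fin k → ℕ => q ^ sumExponent i n / sumDenominator q s n)
      (qPochInf (q ^ i) (s ^ (3 + 4 * k)) *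
          qPochInf (s ^ (3 + 4 * k - 2 * i)) (s ^ (3 + 4 * k)) *
          qPochInf (s ^ (3 + 4 * k)) (s ^ (3 + 4 * k)) /
        qPochInf q q) := by
  subst hs
  have hs1 : ‖s‖ < 1 := by
    rw [norm_pow] at hq
    exact (pow_lt_one_iff_of_nonneg (norm_nonneg _) two_ne_zero).mp hq
  -- Integer powers of `s` require s ≠ 0. At s = 0 only the term n = 0 survives and both sides equal
  -- 1; the truncated exponent 3 + 4k - 2i is positive since i ≤ k + 1.
  rcases eq_or_ne s 0 with rfl | hs
  · rw [zero_pow two_ne_zero, zero_pow (by omega : i ≠ 0),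
      zero_pow (by omega : 3 + 4 * k - 2 * i ≠ 0), zero_pow (by omega : 3 + 4 * k ≠ 0)]
    simp only [qPochInf_zero_left]
    convert hasSum_single (0 : Fin k → ℕ) fun n hn => ?_ using 1
    · simp [sumExponent, sumDenominator, tailSum, entry, qPoch]
    · rw [zero_pow, zero_div]
      intro h
      exact hn (tailSum_one_eq_zero
        (Nat.le_zero.mp ((tailSum_one_le_sumExponent hk i n).trans_eq h)))
  · obtain ⟨k, rfl⟩ := Nat.exists_eq_add_of_le' hk
    have h := (summable_norm_multisum hq hs1 hk i).of_norm.hasSum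
    rw [tsum_multisum hs hs1 k i hi (by omega)] at h
    have ht := tsum_thetaTerm hs hs1 (c := 3 + 4 * (k + 1)) (j := 2 * i) (by omega) (by omega)
    rw [← pow_mul s 2 i, ← ht]
    rwa [show ((3 + 4 * (k + 1) : ℕ) : ℤ) = 4 * k + 7 by push_cast; ring, Nat.cast_mul,
      Nat.cast_two]
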